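/- Let $d\ge 2$ be an integer, let $\mathbb B_d$ be the open unit ball of $\mathbb C^d$, and let $H^2_d$ be the Drury–Arveson space, i.e. the Hilbert space of holomorphic functions on $\mathbb B_d$ with reproducing kernel $k(z,\lambda)=\frac{1}{1-\langle z,\lambda\rangle_{\mathbb C^d}}$; equivalently, the monomials $z^\alpha$, $\alpha\in\mathbb N^d$, form an orthogonal basis of $H^2_d$ with $\|z^\alpha\|^2=\frac{\alpha_1!\cdots\alpha_d!}{(\alpha_1+\dots+\alpha_d)!}$. A function $m:\mathbb B_d\to\mathbb C$ is a multiplier of $H^2_d$ if $mf\in H^2_d$ for all $f\in H^2_d$, and a multiplier $m$ is cyclic if the range of $T_m:H^2_d\to H^2_d$, $f\mapsto mf$, is dense in $H^2_d$ (such an $m$ has no zeros in $\mathbb B_d$). Let $$N^+(H^2_d)=\{\,g/m:\ g\in H^2_d,\ m\text{ a cyclic multiplier of }H^2_d\,\},$$ which is a vector space of functions on $\mathbb B_d$. Let $\tau$ be a topology on $N^+(H^2_d)$ that makes $N^+(H^2_d)$ a topological vector space over $\mathbb C$. Suppose that 1. for every $z\in\mathbb B_d$ the point evaluation $f\mapsto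 f(z)$ is $\tau$-continuous on $N^+(H^2_d)$, and 2. $(N^+(H^2_d),\tau)$ is sequentially complete, i.e. every $\tau$-Cauchy sequence in $N^+(H^2_d)$ converges with respect to $\tau$ to an element of $N^+(H^2_d)$. Then there exists a sequence $(f_n)$ of functions, each analytic in an open neighborhood of the closed ball $\overline{\mathbb B_d}$ and with restriction to $\mathbb B_d$ belonging to $N^+(H^2_d)$, such that $f_n\to 0$ uniformly on $\overline{\mathbb B_d}$, but $(f_n|_{\mathbb B_d})$ does not converge to $0$ with respect to $\tau$. -/

import Mathlib

open Filter Topology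

/-- The open unit ball of `ℂ^d` (Euclidean norm), as a type. -/
abbrev UnitBall (d : ℕ) : Type := ↥(Metric.ball (0 : EuclideanSpace ℂ (Fin d)) 1)

/-- The monomial `z ^ α`. -/
def monom {d : ℕ} (z : EuclideanSpace ℂ (Fin d)) (α : Fin d → ℕ) : ℂ := ∏ i, z i ^ α i

/-- `ω_α = √(α₁! ⋯ α_d! / (α₁ + ⋯ + α_d)!)`. -/
noncomputable def monomNorm {d : ℕ} (α : Fin d → ℕ) : ℝ :=
  Real.sqrt ((∏ i, (Nat.factorial (α i) : ℝ)) / (Nat.factorial (∑ i, α i) : ℝ))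

theorem monomNorm_pos {d : ℕ} (α : Fin d → ℕ) : 0 < monomNorm α := by
  unfold monomNorm
  have : ∀ i, (0 : ℝ) < (Nat.factorial (α i) : ℝ) := fun i => by exact_mod_cast Nat.factorial_pos _
  have h2 : (0 : ℝ) < (Nat.factorial (∑ i, α i) : ℝ) := by exact_mod_cast Nat.factorial_pos _
  have h3 : (0 : ℝ) < ∏ i, (Nat.factorial (α i) : ℝ) := Finset.prod_pos fun i _ => this i
  positivity

theorem monomNorm_sq_inv {d : ℕ} (α : Fin d → ℕ) :
    ((monomNorm α) ^ 2)⁻¹ = (Nat.multinomial Finset.univ α : ℝ) := by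
  unfold monomNorm
  have h := Nat.multinomial_spec Finset.univ α
  have h3 : (0 : ℝ) < ∏ i, (Nat.factorial (α i) : ℝ) :=
    Finset.prod_pos fun i _ => by exact_mod_cast Nat.factorial_pos _
  rw [Real.sq_sqrt (by positivity), inv_div, div_eq_iff h3.ne', ← h]
  push_cast
  ring

/-- The generating function of the multinomial coefficients. -/
theorem hasSum_multinomial_prod {d : ℕ} (x : Fin d → ℂ) (hx : ∑ i, ‖x i‖ < 1) :
    HasSum (fun α : Fin d → ℕ => (Nat.multinomial Finset.univ α : ℂ) * ∏ i, x i ^ α i)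
      (1 - ∑ i, x i)⁻¹ := by
  classical
  have key : ∀ {R : Type} [NormedField R] (y : Fin d → R) (n : ℕ),
      HasSum (fun c : {α : Fin d → ℕ // ∑ i, α i = n} =>
        (Nat.multinomial Finset.univ c.1 : R) * ∏ i, y i ^ c.1 i) ((∑ i, y i) ^ n) := by
    intro R _ y n
    rw [Finset.sum_pow_eq_sum_piAntidiag]
    have hs : ∀ α : Fin d → ℕ, α ∈ Finset.piAntidiag Finset.univ n ↔ ∑ i, α i = n := by
      intro α; simp
    let e : {α : Fin d → ℕ // α ∈ Finset.piAntidiag Finset.univ n} ≃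
      {α : Fin d → ℕ // ∑ i, α i = n} := Equiv.subtypeEquivRight hs
    rw [← e.hasSum_iff]
    exact Finset.hasSum (Finset.piAntidiag Finset.univ n) _
  let e := Equiv.sigmaFiberEquiv (fun α : Fin d → ℕ => ∑ i, α i)
  rw [← e.hasSum_iff]
  have hsum : Summable ((fun α : Fin d → ℕ =>
      (Nat.multinomial Finset.univ α : ℂ) * ∏ i, x i ^ α i) ∘ e) := by
    apply Summable.of_norm
    rw [summable_sigma_of_nonneg (fun _ => norm_nonneg _)]
    have hk : ∀ n, HasSum (fun c : {α : Fin d → ℕ // ∑ i, α i = n} =>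
        ‖((fun α : Fin d → ℕ =>
          (Nat.multinomial Finset.univ α : ℂ) * ∏ i, x i ^ α i) ∘ e) ⟨n, c⟩‖)
        ((∑ i, ‖x i‖) ^ n) := by
      intro n
      convert! key (fun i => ‖x i‖) n using 2 with c
      simp [e, Equiv.sigmaFiberEquiv]
    refine ⟨fun n => (hk n).summable, ?_⟩
    refine (summable_geometric_of_lt_one (Finset.sum_nonneg fun i _ => norm_nonneg _) hx).congr ?_
    intro n
    exact (hk n).tsum_eq.symm
  refine HasSum.sigma_of_hasSum (g := fun n : ℕ => (∑ i, x i) ^ n) ?_ ?_ hsum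
  · exact hasSum_geometric_of_norm_lt_one ((norm_sum_le _ _).trans_lt hx)
  · intro n
    exact key x n

/-- The Drury--Arveson space `H²_d`: the Hilbert space in which the functions `z ^ α / ω_α`,
`α ∈ ℕ^d`, form an orthonormal basis. An element is the square-summable family of its coordinates
in this basis; its function on the ball is given by the `RKHS` instance below. -/
def DruryArveson (d : ℕ) : Type := lp (fun _ : Fin d → ℕ => ℂ) 2

namespace DruryArveson

noncomputable instance (d : ℕ) : NormedAddCommGroup (DruryArveson d) :=
  inferInstanceAs (NormedAddCommGroup (lp (fun _ : Fin d → ℕ => ℂ) 2))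

noncomputable instance (d : ℕ) : InnerProductSpace ℂ (DruryArveson d) :=
  inferInstanceAs (InnerProductSpace ℂ (lp (fun _ : Fin d → ℕ => ℂ) 2))

instance (d : ℕ) : CompleteSpace (DruryArveson d) :=
  inferInstanceAs (CompleteSpace (lp (fun _ : Fin d → ℕ => ℂ) 2))

variable {d : ℕ}

/-- The coordinate of `a` at the basis vector `z ^ α / ω_α`. -/
def coord (a : DruryArveson d) (α : Fin d → ℕ) : ℂ :=
  (show lp (fun _ : Fin d → ℕ => ℂ) 2 from a) α

/-- The function on the ball defined by `a`. -/
noncomputable def toFun (a : DruryArveson d) (z : UnitBall d) : ℂ :=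
  ∑' α : Fin d → ℕ, coord a α * (monom z.1 α / (monomNorm α : ℂ))

theorem sum_norm_mul_lt_one (z w : UnitBall d) :
    ∑ i, ‖z.1 i * (starRingEnd ℂ) (w.1 i)‖ < 1 := by
  have hz : ‖z.1‖ < 1 := mem_ball_zero_iff.1 z.2
  have hw : ‖w.1‖ < 1 := mem_ball_zero_iff.1 w.2
  have h1 : ∑ i, ‖z.1 i * (starRingEnd ℂ) (w.1 i)‖ ≤ ‖z.1‖ * ‖w.1‖ := by
    simp only [norm_mul, RCLike.norm_conj, EuclideanSpace.norm_eq]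
    exact Real.sum_mul_le_sqrt_mul_sqrt _ _ _
  nlinarith [norm_nonneg z.1, norm_nonneg w.1]

theorem hasSum_kernel (z w : UnitBall d) :
    HasSum (fun α : Fin d → ℕ => (monom z.1 α / (monomNorm α : ℂ)) *
      (starRingEnd ℂ) (monom w.1 α / (monomNorm α : ℂ))) (1 - inner ℂ w.1 z.1)⁻¹ := by
  have h := hasSum_multinomial_prod (fun i => z.1 i * (starRingEnd ℂ) (w.1 i))
    (sum_norm_mul_lt_one z w)
  convert! h using 1
  · ext α
    have h1 : (Nat.multinomial Finset.univ α : ℂ) = ((monomNorm α : ℂ) ^ 2)⁻¹ := by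
      have := monomNorm_sq_inv α
      exact_mod_cast this.symm
    have h2 : (monomNorm α : ℂ) ≠ 0 := by exact_mod_cast (monomNorm_pos α).ne'
    rw [h1]
    simp only [monom, map_div₀, map_prod, map_pow, Complex.conj_ofReal, mul_pow,
      Finset.prod_mul_distrib]
    field_simp

/-- The coordinates of the kernel function at `z`. -/
noncomputable def kernelVec (z : UnitBall d) : DruryArveson d :=
  show lp (fun _ : Fin d → ℕ => ℂ) 2 from
  ⟨fun α => (starRingEnd ℂ) (monom z.1 α / (monomNorm α : ℂ)), by
    apply memℓp_gen
    have h := (hasSum_kernel z z).summable.norm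
    refine h.congr fun α => ?_
    simp [pow_two]⟩

theorem coord_kernelVec (z : UnitBall d) (α : Fin d → ℕ) :
    coord (kernelVec z) α = (starRingEnd ℂ) (monom z.1 α / (monomNorm α : ℂ)) := rfl

theorem hasSum_inner (a b : DruryArveson d) :
    HasSum (fun α => coord b α * (starRingEnd ℂ) (coord a α)) (inner ℂ a b) :=
  lp.hasSum_inner (𝕜 := ℂ) (show lp (fun _ : Fin d → ℕ => ℂ) 2 from a)
    (show lp (fun _ : Fin d → ℕ => ℂ) 2 from b)

theorem hasSum_toFun (a : DruryArveson d) (z : UnitBall d) :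
    HasSum (fun α => coord a α * (monom z.1 α / (monomNorm α : ℂ))) (inner ℂ (kernelVec z) a) := by
  have h := hasSum_inner (kernelVec z) a
  simpa only [coord_kernelVec, Complex.conj_conj] using h

theorem toFun_eq_inner (a : DruryArveson d) (z : UnitBall d) :
    toFun a z = inner ℂ (kernelVec z) a :=
  (hasSum_toFun a z).tsum_eq

/-- The power series of an element of the space determines it. -/
theorem eq_zero_of_toFun (a : DruryArveson d) (h : ∀ z, toFun a z = 0) : a = 0 := by
  classical
  let c : (Fin d → ℕ) → ℂ := fun α => coord a α / (monomNorm α : ℂ)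
  have hs : ∀ z : UnitBall d, HasSum (fun α => c α * monom z.1 α) 0 := by
    intro z
    have := hasSum_toFun a z
    rw [← toFun_eq_inner, h z] at this
    convert! this using 2
    simp only [c]; ring
  let P : ℕ → EuclideanSpace ℂ (Fin d) → ℂ := fun n z =>
    ∑ α ∈ Finset.piAntidiag Finset.univ n, c α * monom z α
  have hscale : ∀ (t : ℂ) (z : EuclideanSpace ℂ (Fin d)) (α : Fin d → ℕ),
      monom (t • z) α = t ^ (∑ i, α i) * monom z α := by
    intro t z α
    simp [monom, mul_pow, Finset.prod_mul_distrib, Finset.prod_pow_eq_pow_sum]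
  have hfib : ∀ (z : UnitBall d) (t : ℂ), ‖t‖ ≤ 1 → HasSum (fun n => t ^ n * P n z.1) 0 := by
    intro z t ht
    have hmem : t • z.1 ∈ Metric.ball (0 : EuclideanSpace ℂ (Fin d)) 1 := by
      have hz : ‖z.1‖ < 1 := mem_ball_zero_iff.1 z.2
      rw [mem_ball_zero_iff, norm_smul]
      nlinarith [norm_nonneg z.1, norm_nonneg t]
    have h0 := hs ⟨t • z.1, hmem⟩
    let e := Equiv.sigmaFiberEquiv (fun α : Fin d → ℕ => ∑ i, α i)
    rw [← e.hasSum_iff] at h0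
    refine h0.sigma fun n => ?_
    have hmem2 : ∀ α : Fin d → ℕ, α ∈ Finset.piAntidiag Finset.univ n ↔ ∑ i, α i = n := by
      intro α; simp
    let e2 : {α : Fin d → ℕ // α ∈ Finset.piAntidiag Finset.univ n} ≃
      {α : Fin d → ℕ // ∑ i, α i = n} := Equiv.subtypeEquivRight hmem2
    rw [← e2.hasSum_iff]
    have h1 := Finset.hasSum (Finset.piAntidiag Finset.univ n)
      (fun α : Fin d → ℕ => c α * monom (t • z.1) α)
    convert! h1 using 1
    simp only [P, Finset.mul_sum]
    refine Finset.sum_congr rfl fun α hα => ?_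
    rw [hscale, (hmem2 α).1 hα]
    ring
  have hP : ∀ n (z : UnitBall d), P n z.1 = 0 := by
    intro n z
    let p : FormalMultilinearSeries ℂ ℂ ℂ :=
      FormalMultilinearSeries.ofScalars ℂ (fun n => P n z.1)
    have hp : HasFPowerSeriesAt (fun _ : ℂ => (0 : ℂ)) p 0 := by
      rw [hasFPowerSeriesAt_iff]
      filter_upwards [Metric.closedBall_mem_nhds (0 : ℂ) one_pos] with t ht
      have := hfib z t (by simpa using ht)
      simpa [p, FormalMultilinearSeries.coeff_ofScalars] using this
    have hp0 : p = 0 := HasFPowerSeriesAt.eq_zero hp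
    have : p.coeff n = P n z.1 := by simp [p, FormalMultilinearSeries.coeff_ofScalars]
    rw [← this, hp0]
    rfl
  have hPall : ∀ n (z : EuclideanSpace ℂ (Fin d)), P n z = 0 := by
    intro n z
    have hpos : (0 : ℝ) < 1 + ‖z‖ := by positivity
    let t : ℂ := ((1 + ‖z‖ : ℝ) : ℂ)⁻¹
    have ht0 : t ≠ 0 := inv_ne_zero (by exact_mod_cast hpos.ne')
    have hmem : t • z ∈ Metric.ball (0 : EuclideanSpace ℂ (Fin d)) 1 := by
      rw [mem_ball_zero_iff, norm_smul, norm_inv, Complex.norm_real, Real.norm_of_nonneg hpos.le,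
        inv_mul_lt_iff₀ hpos]
      linarith
    have h1 := hP n ⟨t • z, hmem⟩
    have h2 : P n (t • z) = t ^ n * P n z := by
      simp only [P, Finset.mul_sum]
      refine Finset.sum_congr rfl fun α hα => ?_
      have : ∑ i, α i = n := by simpa using hα
      rw [hscale, this]; ring
    rw [h2] at h1
    exact (mul_eq_zero.1 h1).resolve_left (pow_ne_zero _ ht0)
  have hc : ∀ α, c α = 0 := by
    intro α
    let Q : MvPolynomial (Fin d) ℂ := ∑ β ∈ Finset.piAntidiag Finset.univ (∑ i, α i),
      MvPolynomial.monomial (Finsupp.equivFunOnFinite.symm β) (c β)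
    have hQ : Q = 0 := by
      apply MvPolynomial.funext
      intro x
      have := hPall (∑ i, α i) (WithLp.toLp 2 x)
      simpa [Q, P, monom, MvPolynomial.eval_monomial, Finsupp.prod_fintype] using this
    have h1 : Q.coeff (Finsupp.equivFunOnFinite.symm α) = c α := by
      simp [Q, MvPolynomial.coeff_sum, MvPolynomial.coeff_monomial]
    rw [← h1, hQ]; simp
  have : ∀ α, coord a α = 0 := by
    intro α
    have h2 : (monomNorm α : ℂ) ≠ 0 := by exact_mod_cast (monomNorm_pos α).ne'
    exact (div_eq_zero_iff.1 (hc α)).resolve_right h2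
  exact lp.ext (funext this)

/-- The Drury--Arveson space as a Hilbert space of functions on the ball. -/
noncomputable instance (d : ℕ) : RKHS ℂ (DruryArveson d) (UnitBall d) ℂ where
  coeCLM := ContinuousLinearMap.pi fun z => innerSL ℂ (kernelVec z)
  coeCLM_injective := by
    intro a b hab
    rw [← sub_eq_zero]
    apply eq_zero_of_toFun
    intro z
    have := congrFun hab z
    rw [toFun_eq_inner, inner_sub_right, sub_eq_zero]
    simpa using this

/-- The function of an element with coordinates `a_α` is `z ↦ ∑ α, a_α * z ^ α / ω_α`. -/
theorem apply_eq (a : DruryArveson d) (z : UnitBall d) :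
    a z = ∑' α : Fin d → ℕ, coord a α * (monom z.1 α / (monomNorm α : ℂ)) :=
  (toFun_eq_inner a z).symm

/-- The reproducing kernel is `k(z, w) = 1 / (1 - ⟨z, w⟩)`, with `⟨z, w⟩` linear in `z`. -/
theorem kernel_eq (z w : UnitBall d) :
    RKHS.kernel (DruryArveson d) z w 1 = 1 / (1 - inner ℂ w.1 z.1) := by
  have h1 : RKHS.kerFun (DruryArveson d) w (1 : ℂ) = kernelVec w := by
    apply ext_inner_right ℂ
    intro a
    rw [RKHS.kerFun_inner]
    change inner ℂ (1 : ℂ) (inner ℂ (kernelVec w) a) = _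
    simp
  rw [← RKHS.kerFun_apply, h1]
  change inner ℂ (kernelVec z) (kernelVec w) = _
  rw [one_div]
  refine (hasSum_inner (kernelVec z) (kernelVec w)).unique ?_
  simpa only [coord_kernelVec, Complex.conj_conj, mul_comm] using hasSum_kernel z w

end DruryArveson

/-- `m` is a multiplier of `H²_d`: `m f ∈ H²_d` for every `f ∈ H²_d`. -/
def IsMultiplier {d : ℕ} (m : UnitBall d → ℂ) : Prop :=
  ∀ f : DruryArveson d, ∃ h : DruryArveson d, ∀ z, h z = m z * f z

namespace IsMultiplier

variable {d : ℕ} {m : UnitBall d → ℂ}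

/-- The multiplication operator `T_m : f ↦ m f` on `H²_d`, bounded by the closed graph theorem. -/
noncomputable def mulOp (hm : IsMultiplier m) : DruryArveson d →L[ℂ] DruryArveson d :=
  let T : DruryArveson d →ₗ[ℂ] DruryArveson d :=
    { toFun := fun f => (hm f).choose
      map_add' := fun f g => by
        ext z
        rw [(hm _).choose_spec, RKHS.coe_add, RKHS.coe_add, Pi.add_apply, Pi.add_apply,
          (hm f).choose_spec, (hm g).choose_spec, mul_add]
      map_smul' := fun c f => by
        ext z
        rw [(hm _).choose_spec, RingHom.id_apply, RKHS.coe_smul, RKHS.coe_smul, Pi.smul_apply,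
          Pi.smul_apply, (hm f).choose_spec, smul_eq_mul, smul_eq_mul, mul_left_comm] }
  { T with
    cont := T.continuous_of_seq_closed_graph fun u x y hu hTu => by
      ext z
      have h1 : Tendsto (fun n => (T (u n)) z) atTop (𝓝 (y z)) :=
        ((RKHS.continuous_eval z).tendsto y).comp hTu
      have h2 : Tendsto (fun n => (T (u n)) z) atTop (𝓝 (m z * x z)) := by
        have h3 := (((RKHS.continuous_eval z).tendsto x).comp hu).const_mul (m z)
        exact h3.congr fun n => ((hm (u n)).choose_spec z).symm
      rw [tendsto_nhds_unique h1 h2]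
      exact ((hm x).choose_spec z).symm }

theorem mulOp_apply (hm : IsMultiplier m) (f : DruryArveson d) (z : UnitBall d) :
    hm.mulOp f z = m z * f z :=
  (hm f).choose_spec z

theorem mul {m' : UnitBall d → ℂ} (hm : IsMultiplier m) (hm' : IsMultiplier m') :
    IsMultiplier (m * m') := fun f =>
  ⟨hm.mulOp (hm'.mulOp f), fun z => by
    rw [mulOp_apply, mulOp_apply, Pi.mul_apply, mul_assoc]⟩

end IsMultiplier

/-- `m` is a cyclic multiplier of `H²_d`: a multiplier such that `ran T_m` is dense in `H²_d`. -/
def IsCyclicMultiplier {d : ℕ} (m : UnitBall d → ℂ) : Prop :=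
  ∃ hm : IsMultiplier m, DenseRange hm.mulOp

namespace IsCyclicMultiplier

variable {d : ℕ} {m m' : UnitBall d → ℂ}

theorem one : IsCyclicMultiplier (1 : UnitBall d → ℂ) := by
  have h1 : IsMultiplier (1 : UnitBall d → ℂ) := fun f => ⟨f, fun z => by simp⟩
  refine ⟨h1, Function.Surjective.denseRange fun f => ⟨f, ?_⟩⟩
  ext z
  simp [IsMultiplier.mulOp_apply]

theorem mul (hm : IsCyclicMultiplier m) (hm' : IsCyclicMultiplier m') :
    IsCyclicMultiplier (m * m') := by
  obtain ⟨h, hd⟩ := hm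
  obtain ⟨h', hd'⟩ := hm'
  refine ⟨h.mul h', ?_⟩
  have : ((h.mul h').mulOp : DruryArveson d → DruryArveson d) = h.mulOp ∘ h'.mulOp := by
    funext f
    ext z
    simp [IsMultiplier.mulOp_apply, mul_assoc]
  rw [this]
  exact hd.comp hd' h.mulOp.continuous

/-- A cyclic multiplier has no zeros on the ball. -/
theorem ne_zero (hm : IsCyclicMultiplier m) (z : UnitBall d) : m z ≠ 0 := by
  obtain ⟨h, hd⟩ := hm
  intro hz
  have h0 : ∀ f : DruryArveson d, f z = 0 := by
    intro f
    have hc : IsClosed {f : DruryArveson d | f z = 0} :=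
      isClosed_eq (RKHS.continuous_eval z) continuous_const
    refine hd.induction_on (p := fun f => f z = 0) f hc fun g => ?_
    rw [IsMultiplier.mulOp_apply, hz, zero_mul]
  have h1 : RKHS.kernel (DruryArveson d) z z 1 = 0 := by
    rw [← RKHS.kerFun_apply]
    exact h0 _
  rw [DruryArveson.kernel_eq, one_div, inv_eq_zero, inner_self_eq_norm_sq_to_K] at h1
  have hz1 : ‖z.1‖ < 1 := mem_ball_zero_iff.1 z.2
  have h2 : (1 : ℝ) - ‖z.1‖ ^ 2 = 0 := by
    have h3 := congrArg Complex.re h1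
    rw [← Complex.ofReal_one] at h3
    simpa [← Complex.ofReal_pow] using h3
  nlinarith [norm_nonneg z.1]

end IsCyclicMultiplier

/-- The Smirnov class
`N⁺(H²_d) = {f = g / m : g ∈ H²_d, m a cyclic multiplier of H²_d}`, as a vector space of functions
on the ball with the pointwise operations. (A cyclic multiplier has no zeros.) -/
def smirnovSubmodule (d : ℕ) : Submodule ℂ (UnitBall d → ℂ) where
  carrier := {f | ∃ (g : DruryArveson d) (m : UnitBall d → ℂ),
    IsCyclicMultiplier m ∧ ∀ z, f z = g z / m z}
  zero_mem' := ⟨0, 1, IsCyclicMultiplier.one, fun z => by simp⟩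
  add_mem' := by
    rintro f₁ f₂ ⟨g₁, m₁, h₁, e₁⟩ ⟨g₂, m₂, h₂, e₂⟩
    refine ⟨h₂.1.mulOp g₁ + h₁.1.mulOp g₂, m₁ * m₂, h₁.mul h₂, fun z => ?_⟩
    have n₁ := h₁.ne_zero z
    have n₂ := h₂.ne_zero z
    simp only [Pi.add_apply, Pi.mul_apply, RKHS.coe_add, IsMultiplier.mulOp_apply, e₁, e₂]
    field_simp
  smul_mem' := by
    rintro c f ⟨g, m, h, e⟩
    refine ⟨c • g, m, h, fun z => ?_⟩
    simp [e, mul_div_assoc]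

/-- The vector space `N⁺(H²_d)`. It is a type of its own so that it carries no topology. -/
def Smirnov (d : ℕ) : Type := ↥(smirnovSubmodule d)

namespace Smirnov

instance (d : ℕ) : AddCommGroup (Smirnov d) :=
  inferInstanceAs (AddCommGroup ↥(smirnovSubmodule d))

instance (d : ℕ) : Module ℂ (Smirnov d) :=
  inferInstanceAs (Module ℂ ↥(smirnovSubmodule d))

/-- The value of `f ∈ N⁺(H²_d)` at a point of the ball. -/
def eval {d : ℕ} (f : Smirnov d) (z : UnitBall d) : ℂ :=
  (show ↥(smirnovSubmodule d) from f).1 z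

end Smirnov

/-- Sequential completeness of a topological vector space: every Cauchy sequence converges.
A sequence `u` is Cauchy if for every neighbourhood `U` of `0` eventually `u m - u n ∈ U`. -/
def IsSeqCompleteTVS (E : Type*) [AddCommGroup E] [TopologicalSpace E] : Prop :=
  ∀ u : ℕ → E, (∀ U ∈ 𝓝 (0 : E), ∃ N : ℕ, ∀ m ≥ N, ∀ n ≥ N, u m - u n ∈ U) →
    ∃ x : E, Tendsto u atTop (𝓝 x)

/-! Suppose uniform convergence to zero on the closed ball forced `τ`-convergence to zero. Then a
uniformly Cauchy sequence of polynomials would be `τ`-Cauchy (`Smirnov.cauchy_of_uniform`), hence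
`τ`-convergent, and by continuity of point evaluations its pointwise limit would lie in `N⁺(H²_d)`.
So it is enough to find a uniform limit of polynomials outside `N⁺(H²_d)`; the one used is `L(2 z₀
z₁)` with `L = ∑ 2⁻ᵏ q ^ 256ᵏ`.

The obstruction is smoothness. On the tori `|z₀| = |z₁| = c`, other coordinates zero, `2c² < 1`, the
binomial bound `C(n,j) 2⁻ⁿ ≤ (n+1)^(-1/2)` gives every function in `H²_d` a quarter of an `L²`
derivative along the diagonal rotation, uniformly in `c` (`integral_rotate_sub_le`,
`multinomial_mul_planeRadii_le`). But `L` is rough at every boundary point: rotating by `π/256ᴷ`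
changes it by at least `2⁻ᴷ` (`le_norm_lacunary_sub`), which is Hölder exponent only `1/8`.

If `L(2 z₀ z₁) = g/m`, then `m` itself is in `H²_d`, being `m · 1`. Smoothness of `g` and `m`
against roughness of `L` gives `4⁻ᴷ ∫|m|² ≤ C 16⁻ᴷ` on tori approaching the sphere, while `|m(0)|² ≤
∫|m|²`. Letting `K → ∞` yields `m(0) = 0`, impossible for a cyclic multiplier. -/

open UnitAddTorus

/-! ### Parseval on the torus. -/

open MeasureTheory UnitAddTorus in
/-- The normalized Haar measure on the torus. -/
noncomputable def torusMeasure (d : ℕ) : Measure (UnitAddTorus (Fin d)) :=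
  Measure.pi fun _ => AddCircle.haarAddCircle

open MeasureTheory in
instance (d : ℕ) : IsProbabilityMeasure (torusMeasure d) := by
  unfold torusMeasure; infer_instance

open MeasureTheory UnitAddTorus in
/-- Parseval's identity for absolutely convergent power series on the torus. -/
theorem hasSum_sq_torus {d : ℕ} (b : (Fin d → ℕ) → ℂ) (hb : Summable fun α => ‖b α‖)
    (G : UnitAddTorus (Fin d) → ℂ)
    (hG : ∀ x, HasSum (fun α => b α * mFourier (fun i => (α i : ℤ)) x) (G x)) :
    Continuous G ∧ HasSum (fun α => ‖b α‖ ^ 2) (∫ x, ‖G x‖ ^ 2 ∂torusMeasure d) := by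
  -- Characters have sup norm one, so the series converges in `C(𝕋^d)`; this gives continuity of `G`
  -- and lets the sum be moved into `L²`.
  have hs : Summable fun α : Fin d → ℕ =>
      (b α • mFourier (fun i => (α i : ℤ)) : C(UnitAddTorus (Fin d), ℂ)) := by
    apply Summable.of_norm
    simpa [norm_smul, mFourier_norm] using hb
  obtain ⟨F, hF⟩ := hs
  have hFG : ∀ x, F x = G x := by
    intro x
    have := hF.mapL (ContinuousMap.evalCLM ℂ x)
    exact (this.unique (by simpa using hG x))
  have hGF : G = F := funext fun x => (hFG x).symm
  refine ⟨hGF ▸ F.continuous, ?_⟩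
  have ho : Orthonormal ℂ fun n : Fin d → ℤ =>
      (ContinuousMap.toLp (E := ℂ) 2 (torusMeasure d) ℂ (mFourier n)) := orthonormal_mFourier
  have ho' := ho.comp (fun α : Fin d → ℕ => fun i => (α i : ℤ)) (by
    intro α β h
    ext i
    simpa using congrFun h i)
  have hL := hF.mapL (ContinuousMap.toLp (E := ℂ) 2 (torusMeasure d) ℂ)
  set L := ContinuousMap.toLp (E := ℂ) 2 (torusMeasure d) ℂ
  set e := (fun n : Fin d → ℤ => L (mFourier n)) ∘ (fun α : Fin d → ℕ => fun i => (α i : ℤ))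
  have hL' : HasSum (fun α => b α • e α) (L F) := by simpa [e] using hL
  have hcoef : ∀ α, inner ℂ (e α) (L F) = b α := by
    intro α
    have h1 := hL'.mapL (innerSL ℂ (e α))
    refine h1.unique ?_
    have h2 : (fun β => innerSL ℂ (e α) (b β • e β)) = fun β => if β = α then b α else 0 := by
      funext β
      by_cases h : β = α
      · subst h
        simp [ho'.1 β]
      · simp [ho'.2 (Ne.symm h), h]
    rw [h2]
    exact hasSum_ite_eq α (b α)
  -- Pairing the expansion of `L F` with `L F` itself produces both sides of Parseval.
  have h3 := hL'.mapL (innerSL ℂ (L F))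
  have h4 : inner ℂ (L F) (L F) = ((∫ x, ‖G x‖ ^ 2 ∂torusMeasure d : ℝ) : ℂ) := by
    rw [ContinuousMap.inner_toLp, ← integral_complex_ofReal]
    congr 1
    funext x
    rw [hFG]
    simp [Complex.mul_conj, Complex.normSq_eq_norm_sq]
  have h5 : (fun α => innerSL ℂ (L F) (b α • e α)) = fun α => ((‖b α‖ ^ 2 : ℝ) : ℂ) := by
    funext α
    rw [innerSL_apply_apply, inner_smul_right, ← inner_conj_symm, hcoef]
    simp [Complex.mul_conj, Complex.normSq_eq_norm_sq]
  rw [h5, innerSL_apply_apply, h4] at h3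
  exact_mod_cast h3

/-! ### Binomial and exponential estimates. -/

theorem centralBinom_sq_mul_le (n : ℕ) : n.centralBinom ^ 2 * (2 * n + 1) ≤ 16 ^ n := by
  induction n with
  | zero => simp
  | succ n ih =>
    have h := Nat.succ_mul_centralBinom_succ n
    have h1 : (n + 1) ^ 2 * ((n + 1).centralBinom ^ 2 * (2 * (n + 1) + 1)) ≤
        (n + 1) ^ 2 * 16 ^ (n + 1) := by
      calc (n + 1) ^ 2 * ((n + 1).centralBinom ^ 2 * (2 * (n + 1) + 1))
          = ((n + 1) * (n + 1).centralBinom) ^ 2 * (2 * (n + 1) + 1) := by ring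
        _ = (n.centralBinom ^ 2 * (2 * n + 1)) * (4 * ((2 * n + 1) * (2 * n + 3))) := by
          rw [h]; ring
        _ ≤ 16 ^ n * (16 * (n + 1) ^ 2) := Nat.mul_le_mul ih (by nlinarith)
        _ = _ := by ring
    exact Nat.le_of_mul_le_mul_left h1 (by positivity)

/-- The `n^(-1/2)` decay of `C(n,j) 2⁻ⁿ` is the source of the extra smoothness on tori. The even
case is the central binomial bound; for odd `n = 2k+1` the middle coefficient is half of the central
one for `k+1`. -/
theorem choose_sq_mul_le (n j : ℕ) : n.choose j ^ 2 * (n + 1) ≤ 4 ^ n := by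
  obtain ⟨k, rfl | rfl⟩ := n.even_or_odd'
  · calc (2 * k).choose j ^ 2 * (2 * k + 1) ≤ k.centralBinom ^ 2 * (2 * k + 1) := by
          gcongr; exact Nat.choose_le_centralBinom _ _
      _ ≤ 16 ^ k := centralBinom_sq_mul_le k
      _ = 4 ^ (2 * k) := by rw [pow_mul]; norm_num
  · have h1 : (2 * k + 1).choose j ≤ (2 * k + 1).choose k := by
      have := Nat.choose_le_middle j (2 * k + 1)
      rwa [show (2 * k + 1) / 2 = k by omega] at this
    have h2 : (k + 1).centralBinom = 2 * (2 * k + 1).choose k := by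
      rw [Nat.centralBinom_eq_two_mul_choose, show 2 * (k + 1) = (2 * k + 1) + 1 by ring,
        Nat.choose_succ_succ, Nat.choose_symm_half]
      ring
    have h3 := centralBinom_sq_mul_le (k + 1)
    rw [h2] at h3
    have h4 : (2 * k + 1).choose j ^ 2 ≤ (2 * k + 1).choose k ^ 2 := by gcongr
    have h5 : 16 ^ (k + 1) = 4 * 4 ^ (2 * k + 1) := by
      rw [pow_succ, pow_succ, pow_mul]; norm_num; ring
    rw [h5] at h3
    nlinarith

/-- Interpolates between the bounds `θ` and `2`. The power `√θ` is chosen to match the weight `√|α|`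
available in `H²_d`. -/
theorem norm_exp_sub_one_sq_le (θ : ℝ) (hθ : 0 ≤ θ) :
    ‖Complex.exp (Complex.I * θ) - 1‖ ^ 2 ≤ 4 * √θ := by
  have h1 : ‖Complex.exp (Complex.I * θ) - 1‖ ≤ θ := by
    simpa [abs_of_nonneg hθ] using Real.norm_exp_I_mul_ofReal_sub_one_le (x := θ)
  have h2 : ‖Complex.exp (Complex.I * θ) - 1‖ ≤ 2 := by
    refine (norm_sub_le _ _).trans ?_
    rw [Complex.norm_exp_I_mul_ofReal]; norm_num
  have h0 := norm_nonneg (Complex.exp (Complex.I * θ) - 1)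
  have hs := Real.sq_sqrt hθ
  have hs0 := Real.sqrt_nonneg θ
  by_cases h : θ ≤ 1
  · have h3 : √θ ≤ 1 := Real.sqrt_le_one.2 h
    nlinarith
  · have h3 : 1 ≤ √θ := Real.one_le_sqrt.2 (by linarith)
    nlinarith

/-! ### The lacunary series. -/

/-- A lacunary power series, continuous on the closed disc, whose boundary values are not Hölder
continuous of exponent greater than `1 / 8`. -/
noncomputable def lacunary (q : ℂ) : ℂ := ∑' k : ℕ, (1 / 2 : ℂ) ^ k * q ^ 256 ^ k

theorem norm_lacunary_term_le {q : ℂ} (hq : ‖q‖ ≤ 1) (k : ℕ) :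
    ‖(1 / 2 : ℂ) ^ k * q ^ 256 ^ k‖ ≤ (1 / 2 : ℝ) ^ k := by
  rw [norm_mul, norm_pow, norm_pow]
  have : ‖q‖ ^ 256 ^ k ≤ 1 := pow_le_one₀ (norm_nonneg q) hq
  calc ‖(1 / 2 : ℂ)‖ ^ k * ‖q‖ ^ 256 ^ k ≤ ‖(1 / 2 : ℂ)‖ ^ k * 1 := by gcongr
    _ = (1 / 2 : ℝ) ^ k := by norm_num

theorem hasSum_lacunary {q : ℂ} (hq : ‖q‖ ≤ 1) :
    HasSum (fun k : ℕ => (1 / 2 : ℂ) ^ k * q ^ 256 ^ k) (lacunary q) :=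
  (Summable.of_norm_bounded summable_geometric_two (norm_lacunary_term_le hq)).hasSum

theorem norm_lacunary_le {q : ℂ} (hq : ‖q‖ ≤ 1) : ‖lacunary q‖ ≤ 2 :=
  tsum_of_norm_bounded hasSum_geometric_two (norm_lacunary_term_le hq)

/-- The rotation flips the sign of the `K`-th term, fixes all later terms because `256` is even, and
barely moves the earlier ones because their frequencies are much smaller. The `K`-th term therefore
dominates the difference. -/
theorem le_norm_lacunary_sub (K : ℕ) {q : ℂ} (hq : ‖q‖ ≤ 1) (hq' : 3 / 4 ≤ ‖q‖ ^ 256 ^ K) :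
    (1 / 2 : ℝ) ^ K ≤
      ‖lacunary (Complex.exp (Complex.I * ((Real.pi / 256 ^ K : ℝ) : ℂ)) * q) - lacunary q‖ := by
  set ζ := Complex.exp (Complex.I * ((Real.pi / 256 ^ K : ℝ) : ℂ)) with hζ
  have hpow : ∀ n : ℕ, ζ ^ n = Complex.exp (Complex.I * ((n * (Real.pi / 256 ^ K) : ℝ) : ℂ)) := by
    intro n
    rw [hζ, ← Complex.exp_nat_mul]
    congr 1
    push_cast
    ring
  have hζn : ‖ζ‖ = 1 := Complex.norm_exp_I_mul_ofReal _
  have hK : ζ ^ 256 ^ K = -1 := by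
    rw [hpow]
    have : ((256 ^ K : ℕ) : ℝ) * (Real.pi / 256 ^ K) = Real.pi := by
      push_cast; field_simp
    rw [this, mul_comm, Complex.exp_pi_mul_I]
  have hlarge : ∀ k ∉ Finset.range (K + 1),
      (1 / 2 : ℂ) ^ k * (ζ * q) ^ 256 ^ k - (1 / 2 : ℂ) ^ k * q ^ 256 ^ k = 0 := by
    intro k hk
    have hk' : K + 1 ≤ k := by simpa using hk
    obtain ⟨j, rfl⟩ := Nat.exists_eq_add_of_le hk'
    have : ζ ^ 256 ^ (K + 1 + j) = 1 := by
      rw [show 256 ^ (K + 1 + j) = 256 ^ K * (2 * (128 * 256 ^ j)) by ring, pow_mul, hK, pow_mul]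
      norm_num
    rw [mul_pow, this]; ring
  have hsum := ((hasSum_lacunary (q := ζ * q) (by rw [norm_mul, hζn, one_mul]; exact hq)).sub
    (hasSum_lacunary hq)).unique (hasSum_sum_of_ne_finset_zero hlarge)
  rw [hsum, Finset.sum_range_succ]
  have hlast : ‖(1 / 2 : ℂ) ^ K * (ζ * q) ^ 256 ^ K - (1 / 2 : ℂ) ^ K * q ^ 256 ^ K‖ ≥
      3 / 2 * (1 / 2 : ℝ) ^ K := by
    rw [mul_pow, hK, show (1 / 2 : ℂ) ^ K * (-1 * q ^ 256 ^ K) - (1 / 2 : ℂ) ^ K * q ^ 256 ^ K =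
      -(2 * ((1 / 2 : ℂ) ^ K * q ^ 256 ^ K)) by ring]
    simp only [norm_neg, norm_mul, norm_pow]
    have h2 : ‖(1 / 2 : ℂ)‖ = 1 / 2 := by norm_num
    rw [h2, Complex.norm_ofNat]
    have := pow_pos (show (0 : ℝ) < 1 / 2 by norm_num) K
    nlinarith
  -- Term `k` moves by at most its frequency times the angle, so the sum is geometric with ratio
  -- `256/2 = 128`, and `π/127` is far below `1/2`.
  have hfirst : ‖∑ k ∈ Finset.range K,
      ((1 / 2 : ℂ) ^ k * (ζ * q) ^ 256 ^ k - (1 / 2 : ℂ) ^ k * q ^ 256 ^ k)‖ ≤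
      1 / 2 * (1 / 2 : ℝ) ^ K := by
    have hb : ∀ k ∈ Finset.range K,
        ‖(1 / 2 : ℂ) ^ k * (ζ * q) ^ 256 ^ k - (1 / 2 : ℂ) ^ k * q ^ 256 ^ k‖ ≤
        Real.pi / 256 ^ K * 128 ^ k := by
      intro k _
      rw [show (1 / 2 : ℂ) ^ k * (ζ * q) ^ 256 ^ k - (1 / 2 : ℂ) ^ k * q ^ 256 ^ k =
        (ζ ^ 256 ^ k - 1) * ((1 / 2 : ℂ) ^ k * q ^ 256 ^ k) by ring, norm_mul]
      have h1 : ‖ζ ^ 256 ^ k - 1‖ ≤ ((256 ^ k : ℕ) : ℝ) * (Real.pi / 256 ^ K) := by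
        rw [hpow]
        refine Real.norm_exp_I_mul_ofReal_sub_one_le.trans (le_of_eq ?_)
        exact Real.norm_of_nonneg (by positivity)
      calc _ ≤ (((256 ^ k : ℕ) : ℝ) * (Real.pi / 256 ^ K)) * (1 / 2 : ℝ) ^ k := by
            gcongr; exact norm_lacunary_term_le hq k
        _ = Real.pi / 256 ^ K * (256 ^ k * (1 / 2) ^ k) := by push_cast; ring
        _ = _ := by rw [← mul_pow]; norm_num
    refine (norm_sum_le_of_le _ hb).trans ?_
    rw [← Finset.mul_sum, geom_sum_eq (by norm_num)]
    have h3 : ((128 : ℝ) ^ K - 1) / (128 - 1) ≤ 128 ^ K / 127 := by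
      rw [div_le_div_iff₀ (by norm_num) (by norm_num)]; linarith
    calc Real.pi / 256 ^ K * (((128 : ℝ) ^ K - 1) / (128 - 1))
        ≤ Real.pi / 256 ^ K * (128 ^ K / 127) := mul_le_mul_of_nonneg_left h3 (by positivity)
      _ ≤ 4 / 256 ^ K * (128 ^ K / 127) := by
          gcongr; exact Real.pi_le_four
      _ = 4 / 127 * (128 ^ K / 256 ^ K) := by ring
      _ = 4 / 127 * (1 / 2) ^ K := by rw [← div_pow]; norm_num
      _ ≤ _ := mul_le_mul_of_nonneg_right (by norm_num) (by positivity)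
  have h4 := norm_sub_le_norm_add
    (∑ k ∈ Finset.range K, ((1 / 2 : ℂ) ^ k * (ζ * q) ^ 256 ^ k - (1 / 2 : ℂ) ^ k * q ^ 256 ^ k))
    ((1 / 2 : ℂ) ^ K * (ζ * q) ^ 256 ^ K - (1 / 2 : ℂ) ^ K * q ^ 256 ^ K)
  have h5 := norm_sub_norm_le ((1 / 2 : ℂ) ^ K * (ζ * q) ^ 256 ^ K - (1 / 2 : ℂ) ^ K * q ^ 256 ^ K)
    (-(∑ k ∈ Finset.range K,
      ((1 / 2 : ℂ) ^ k * (ζ * q) ^ 256 ^ k - (1 / 2 : ℂ) ^ k * q ^ 256 ^ k)))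
  rw [norm_neg, sub_neg_eq_add, add_comm] at h5
  linarith

/-! ### Tori in the ball and their diagonal rotation. -/

theorem norm_fourier_one (x : UnitAddCircle) : ‖(fourier 1 x : ℂ)‖ = 1 := by
  rw [fourier_apply]; exact Circle.norm_coe _

/-- The point of the ball with polar coordinates `ρ` and `x`. -/
noncomputable def polarPoint {d : ℕ} (ρ : Fin d → ℝ) (hρ : ∑ i, ρ i ^ 2 < 1)
    (x : UnitAddTorus (Fin d)) : UnitBall d :=
  ⟨WithLp.toLp 2 fun i => (ρ i : ℂ) * fourier 1 (x i), by
    rw [mem_ball_zero_iff, EuclideanSpace.norm_eq, Real.sqrt_lt' one_pos]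
    simpa only [norm_mul, norm_fourier_one, mul_one, Complex.norm_real, Real.norm_eq_abs, sq_abs, one_pow]
      using hρ⟩

theorem monom_polarPoint {d : ℕ} (ρ : Fin d → ℝ) (hρ : ∑ i, ρ i ^ 2 < 1)
    (x : UnitAddTorus (Fin d)) (α : Fin d → ℕ) :
    monom (polarPoint ρ hρ x).1 α =
      ((∏ i, ρ i ^ α i : ℝ) : ℂ) * mFourier (fun i => (α i : ℤ)) x := by
  simp only [monom, polarPoint, mul_pow, Finset.prod_mul_distrib, mFourier, ContinuousMap.coe_mk]
  push_cast
  congr 1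
  refine Finset.prod_congr rfl fun i _ => ?_
  simp [fourier_apply, AddCircle.toCircle_nsmul]

/-- The diagonal rotation of the torus by the angle `s`. -/
noncomputable def rotate {d : ℕ} (s : ℝ) (x : UnitAddTorus (Fin d)) : UnitAddTorus (Fin d) :=
  fun i => x i + ((s : ℝ) : UnitAddCircle)

theorem fourier_one_add_coe (x : UnitAddCircle) (s : ℝ) :
    fourier 1 (x + ((s : ℝ) : UnitAddCircle)) =
      Complex.exp (Complex.I * ((2 * Real.pi * s : ℝ) : ℂ)) * fourier 1 x := by
  rw [fourier_apply, fourier_apply, smul_add, AddCircle.toCircle_add, Circle.coe_mul, mul_comm]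
  congr 1
  rw [one_smul, AddCircle.toCircle_apply_mk, Circle.coe_exp]
  congr 1
  push_cast
  ring

theorem mFourier_rotate {d : ℕ} (s : ℝ) (x : UnitAddTorus (Fin d)) (α : Fin d → ℕ) :
    mFourier (fun i => (α i : ℤ)) (rotate s x) =
      Complex.exp (Complex.I * ((2 * Real.pi * s * (∑ i, α i : ℕ) : ℝ) : ℂ)) *
        mFourier (fun i => (α i : ℤ)) x := by
  have h : ∀ (n : ℕ) (y : UnitAddCircle), fourier (n : ℤ) y = fourier 1 y ^ n := by
    intro n y
    simp [fourier_apply, AddCircle.toCircle_nsmul]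
  simp only [mFourier, ContinuousMap.coe_mk, rotate, h, fourier_one_add_coe, mul_pow,
    Finset.prod_mul_distrib, Finset.prod_pow_eq_pow_sum]
  rw [← Complex.exp_nat_mul]
  congr 2
  push_cast
  ring

/-! ### Smoothness of `H²_d` functions on tori. -/

namespace DruryArveson

variable {d : ℕ}

theorem hasSum_norm_coord_sq (a : DruryArveson d) :
    HasSum (fun α => ‖coord a α‖ ^ 2) (‖a‖ ^ 2) := by
  have h := hasSum_inner a a
  have h' : inner ℂ a a = ((‖a‖ ^ 2 : ℝ) : ℂ) := by
    rw [inner_self_eq_norm_sq_to_K]; simp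
  rw [h'] at h
  simp only [Complex.mul_conj, Complex.normSq_eq_norm_sq] at h
  exact_mod_cast h

theorem hasSum_polarPoint (a : DruryArveson d) (ρ : Fin d → ℝ) (hρ : ∑ i, ρ i ^ 2 < 1)
    (x : UnitAddTorus (Fin d)) :
    HasSum (fun α => (coord a α * (((∏ i, ρ i ^ α i : ℝ) : ℂ) / (monomNorm α : ℂ))) *
      mFourier (fun i => (α i : ℤ)) x) (a (polarPoint ρ hρ x)) := by
  rw [apply_eq]
  change HasSum _ (toFun a _)
  rw [toFun_eq_inner]
  convert! hasSum_toFun a (polarPoint ρ hρ x) using 2 with α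
  rw [monom_polarPoint]
  ring

theorem summable_polarPoint (a : DruryArveson d) (ρ : Fin d → ℝ) (hρ : ∑ i, ρ i ^ 2 < 1) :
    Summable fun α => ‖coord a α * (((∏ i, ρ i ^ α i : ℝ) : ℂ) / (monomNorm α : ℂ))‖ := by
  -- At `x = 0` every character equals one, leaving only the coefficients.
  have h := (hasSum_polarPoint a ρ hρ 0).summable.norm
  simpa [mFourier] using h

theorem continuous_polarPoint (a : DruryArveson d) (ρ : Fin d → ℝ) (hρ : ∑ i, ρ i ^ 2 < 1) :
    Continuous fun x => a (polarPoint ρ hρ x) :=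
  (hasSum_sq_torus _ (summable_polarPoint a ρ hρ) _ (hasSum_polarPoint a ρ hρ)).1

/-- The value at the origin is the zeroth Fourier coefficient on the torus, so Parseval bounds it.
-/
theorem norm_sq_zero_le_integral (a : DruryArveson d) (ρ : Fin d → ℝ) (hρ : ∑ i, ρ i ^ 2 < 1) :
    ‖a ⟨0, Metric.mem_ball_self one_pos⟩‖ ^ 2 ≤
      ∫ x, ‖a (polarPoint ρ hρ x)‖ ^ 2 ∂torusMeasure d := by
  have h := (hasSum_sq_torus _ (summable_polarPoint a ρ hρ) _ (hasSum_polarPoint a ρ hρ)).2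
  have h0 := h.summable.le_tsum 0 fun _ _ => by positivity
  rw [h.tsum_eq] at h0
  refine le_trans (le_of_eq ?_) h0
  rw [apply_eq, tsum_eq_single 0]
  · simp [monom]
  · intro α hα
    obtain ⟨i, hi⟩ := Function.ne_iff.1 hα
    have : monom (0 : EuclideanSpace ℂ (Fin d)) α = 0 := by
      refine Finset.prod_eq_zero (Finset.mem_univ i) ?_
      simpa using hi
    simp [this]

/-- On tori whose radii satisfy the stated bound, functions in the Drury--Arveson space have half
a derivative more than square-summability. -/
theorem integral_rotate_sub_le (a : DruryArveson d) (ρ : Fin d → ℝ) (hρ : ∑ i, ρ i ^ 2 < 1)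
    (hw : ∀ α : Fin d → ℕ, (Nat.multinomial Finset.univ α : ℝ) * (∏ i, ρ i ^ α i) ^ 2 *
      √(∑ i, α i : ℕ) ≤ 1) (s : ℝ) (hs : 0 ≤ s) :
    ∫ x, ‖a (polarPoint ρ hρ (rotate s x)) - a (polarPoint ρ hρ x)‖ ^ 2 ∂torusMeasure d ≤
      4 * √(2 * Real.pi * s) * ‖a‖ ^ 2 := by
  let b : (Fin d → ℕ) → ℂ := fun α =>
    coord a α * (((∏ i, ρ i ^ α i : ℝ) : ℂ) / (monomNorm α : ℂ))
  let e : (Fin d → ℕ) → ℂ := fun α =>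
    Complex.exp (Complex.I * ((2 * Real.pi * s * (∑ i, α i : ℕ) : ℝ) : ℂ))
  have he : ∀ α, ‖e α - 1‖ ≤ 2 := fun α => by
    refine (norm_sub_le _ _).trans ?_
    simp only [e]
    rw [Complex.norm_exp_I_mul_ofReal]; norm_num
  have hsum : Summable fun α => ‖(e α - 1) * b α‖ := by
    refine Summable.of_nonneg_of_le (fun _ => norm_nonneg _) (fun α => ?_)
      ((summable_polarPoint a ρ hρ).mul_left 2)
    rw [norm_mul]
    exact mul_le_mul_of_nonneg_right (he α) (norm_nonneg _)
  have hG : ∀ x, HasSum (fun α => ((e α - 1) * b α) * mFourier (fun i => (α i : ℤ)) x)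
      (a (polarPoint ρ hρ (rotate s x)) - a (polarPoint ρ hρ x)) := by
    intro x
    convert! (hasSum_polarPoint a ρ hρ (rotate s x)).sub (hasSum_polarPoint a ρ hρ x) using 2
      with α
    rw [mFourier_rotate]
    simp only [b, e]
    ring
  refine hasSum_le (fun α => ?_) (hasSum_sq_torus _ hsum _ hG).2
    ((hasSum_norm_coord_sq a).mul_left _)
  have h1 : ‖b α‖ ^ 2 = ‖coord a α‖ ^ 2 *
      ((Nat.multinomial Finset.univ α : ℝ) * (∏ i, ρ i ^ α i) ^ 2) := by
    simp only [b]
    rw [norm_mul, norm_div, Complex.norm_real, Complex.norm_real, ← monomNorm_sq_inv, mul_pow,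
      div_pow, Real.norm_eq_abs, Real.norm_eq_abs, sq_abs, sq_abs]
    ring
  -- The angle is `2πs|α|`; its square root splits off `√|α|`, which the weight hypothesis `hw`
  -- absorbs.
  have h2 : ‖e α - 1‖ ^ 2 ≤ 4 * (√(2 * Real.pi * s) * √(∑ i, α i : ℕ)) := by
    rw [← Real.sqrt_mul (by positivity)]
    exact norm_exp_sub_one_sq_le _ (by positivity)
  rw [norm_mul, mul_pow, h1]
  calc ‖e α - 1‖ ^ 2 * (‖coord a α‖ ^ 2 *
        ((Nat.multinomial Finset.univ α : ℝ) * (∏ i, ρ i ^ α i) ^ 2))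
      ≤ 4 * (√(2 * Real.pi * s) * √(∑ i, α i : ℕ)) * (‖coord a α‖ ^ 2 *
        ((Nat.multinomial Finset.univ α : ℝ) * (∏ i, ρ i ^ α i) ^ 2)) := by gcongr
    _ = 4 * √(2 * Real.pi * s) * ‖coord a α‖ ^ 2 *
        ((Nat.multinomial Finset.univ α : ℝ) * (∏ i, ρ i ^ α i) ^ 2 * √(∑ i, α i : ℕ)) := by ring
    _ ≤ 4 * √(2 * Real.pi * s) * ‖coord a α‖ ^ 2 * 1 := by gcongr; exact hw α
    _ = _ := mul_one _

end DruryArveson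

/-! ### Tori in a coordinate plane. -/

/-- The radii of a torus lying in the plane of two coordinates. -/
def planeRadii {d : ℕ} (i₀ i₁ : Fin d) (c : ℝ) (i : Fin d) : ℝ := if i = i₀ ∨ i = i₁ then c else 0

theorem sum_planeRadii_sq {d : ℕ} {i₀ i₁ : Fin d} (h : i₀ ≠ i₁) (c : ℝ) :
    ∑ i, planeRadii i₀ i₁ c i ^ 2 = 2 * c ^ 2 := by
  classical
  rw [← Finset.sum_subset (Finset.subset_univ {i₀, i₁}), Finset.sum_pair h]
  · simp [planeRadii]; ring
  · intro i _ hi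
    have : ¬(i = i₀ ∨ i = i₁) := by simpa using hi
    simp [planeRadii, this]

theorem multinomial_mul_planeRadii_le {d : ℕ} {i₀ i₁ : Fin d} (h : i₀ ≠ i₁) {c : ℝ}
    (hc : 2 * c ^ 2 ≤ 1) (α : Fin d → ℕ) :
    (Nat.multinomial Finset.univ α : ℝ) * (∏ i, planeRadii i₀ i₁ c i ^ α i) ^ 2 *
      √(∑ i, α i : ℕ) ≤ 1 := by
  classical
  -- An exponent off the plane kills the product unless it is zero, when `0 ^ 0 = 1`. Only indices
  -- supported on `i₀`, `i₁` matter, and there the multinomial is binomial.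
  by_cases hα : ∀ i, ¬(i = i₀ ∨ i = i₁) → α i = 0
  · have hz : ∀ i ∈ Finset.univ, i ∉ ({i₀, i₁} : Finset (Fin d)) → α i = 0 := fun i _ hi =>
      hα i (by simpa using hi)
    have h1 : ∑ i, α i = α i₀ + α i₁ := by
      rw [← Finset.sum_subset (Finset.subset_univ {i₀, i₁}) hz, Finset.sum_pair h]
    have h2 : ∏ i, planeRadii i₀ i₁ c i ^ α i = c ^ (α i₀ + α i₁) := by
      rw [← Finset.prod_subset (Finset.subset_univ {i₀, i₁}), Finset.prod_pair h]
      · simp [planeRadii, pow_add]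
      · intro i hi hi'
        rw [hz i hi hi', pow_zero]
    have h3 : Nat.multinomial Finset.univ α = (α i₀ + α i₁).choose (α i₀) := by
      rw [← Nat.binomial_eq_choose h]
      unfold Nat.multinomial
      rw [h1, Finset.sum_pair h, Finset.prod_pair h,
        ← Finset.prod_subset (Finset.subset_univ {i₀, i₁}), Finset.prod_pair h]
      intro i hi hi'
      rw [hz i hi hi', Nat.factorial_zero]
    rw [h1, h2, h3]
    set n := α i₀ + α i₁
    have h4 : (n.choose (α i₀) : ℝ) * √(n : ℝ) ≤ 2 ^ n := by
      refine abs_le_of_sq_le_sq' ?_ (by positivity) |>.2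
      rw [mul_pow, Real.sq_sqrt (by positivity), ← pow_mul, mul_comm n, pow_mul]
      have := choose_sq_mul_le n (α i₀)
      have h5 : ((n.choose (α i₀) ^ 2 * n : ℕ) : ℝ) ≤ ((4 ^ n : ℕ) : ℝ) := by
        exact_mod_cast (Nat.mul_le_mul_left _ n.le_succ).trans this
      push_cast at h5
      norm_num
      exact h5
    calc (n.choose (α i₀) : ℝ) * (c ^ n) ^ 2 * √(n : ℝ)
        = (n.choose (α i₀) * √(n : ℝ)) * (c ^ 2) ^ n := by rw [← pow_mul, ← pow_mul]; ring
      _ ≤ 2 ^ n * (c ^ 2) ^ n := by gcongr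
      _ = (2 * c ^ 2) ^ n := (mul_pow _ _ _).symm
      _ ≤ 1 := pow_le_one₀ (by positivity) hc
  · push Not at hα
    obtain ⟨i, hi, hi'⟩ := hα
    have : ∏ i, planeRadii i₀ i₁ c i ^ α i = 0 := by
      refine Finset.prod_eq_zero (Finset.mem_univ i) ?_
      simp [planeRadii, hi, hi']
    simp [this]

theorem continuous_rotate {d : ℕ} (s : ℝ) :
    Continuous (rotate s : UnitAddTorus (Fin d) → UnitAddTorus (Fin d)) := by
  unfold rotate; fun_prop

theorem product_polarPoint {d : ℕ} (i₀ i₁ : Fin d) (c : ℝ)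
    (hρ : ∑ i, planeRadii i₀ i₁ c i ^ 2 < 1) (x : UnitAddTorus (Fin d)) :
    2 * (polarPoint _ hρ x).1 i₀ * (polarPoint _ hρ x).1 i₁ =
      ((2 * c ^ 2 : ℝ) : ℂ) * (fourier 1 (x i₀) * fourier 1 (x i₁)) := by
  simp only [polarPoint, planeRadii]
  simp
  ring

theorem norm_two_mul_mul_le {d : ℕ} {i₀ i₁ : Fin d} (h : i₀ ≠ i₁)
    (z : EuclideanSpace ℂ (Fin d)) (hz : ‖z‖ ≤ 1) : ‖2 * z i₀ * z i₁‖ ≤ 1 := by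
  classical
  have h1 : ∑ i ∈ {i₀, i₁}, ‖z i‖ ^ 2 ≤ ‖z‖ ^ 2 := by
    rw [EuclideanSpace.norm_sq_eq]
    exact Finset.sum_le_sum_of_subset_of_nonneg (Finset.subset_univ _) fun _ _ _ => by positivity
  rw [Finset.sum_pair h] at h1
  rw [norm_mul, norm_mul, Complex.norm_ofNat]
  have h2 : ‖z‖ ^ 2 ≤ 1 := pow_le_one₀ (norm_nonneg _) hz
  nlinarith [sq_nonneg (‖z i₀‖ - ‖z i₁‖)]

/-! ### The lacunary function is not a quotient. -/

-- Compares, at scale `256⁻ᴷ`, the jump of the lacunary factor with the mean-square variation of `g`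
-- and `m` on one torus.
open MeasureTheory in
theorem norm_sq_le_of_lacunary_mul {d : ℕ} {i₀ i₁ : Fin d} (h : i₀ ≠ i₁) (g m : DruryArveson d)
    (hg : ∀ z : UnitBall d, g z = m z * lacunary (2 * z.1 i₀ * z.1 i₁)) (K : ℕ) :
    ‖m ⟨0, Metric.mem_ball_self one_pos⟩‖ ^ 2 ≤
      (16 * ‖g‖ ^ 2 + 64 * ‖m‖ ^ 2) * (1 / 4 : ℝ) ^ K := by
  set N : ℝ := 256 ^ K with hN
  have hN1 : 1 ≤ N := one_le_pow₀ (by norm_num)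
  -- Bernoulli's inequality makes `tᴺ ≥ 3/4`, so the `K`-th term keeps its size although the torus
  -- stays inside the open ball.
  set t : ℝ := 1 - 1 / (4 * N) with ht
  have ht1 : t < 1 := sub_lt_self _ (by positivity)
  have ht0 : 0 ≤ t := by
    have : 1 / (4 * N) ≤ 1 := by rw [div_le_one (by positivity)]; linarith
    linarith
  have htN : 3 / 4 ≤ t ^ 256 ^ K := by
    have h1 := one_add_mul_le_pow (a := -(1 / (4 * N))) (by linarith) (256 ^ K)
    have h2 : 1 + ((256 ^ K : ℕ) : ℝ) * -(1 / (4 * N)) = 3 / 4 := by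
      push_cast; rw [← hN]; field_simp; norm_num
    rw [h2] at h1
    rwa [ht, sub_eq_add_neg]
  have hc : 2 * √(t / 2) ^ 2 = t := by rw [Real.sq_sqrt (by linarith)]; ring
  set c := √(t / 2)
  have hρ : ∑ i, planeRadii i₀ i₁ c i ^ 2 < 1 := by rw [sum_planeRadii_sq h, hc]; exact ht1
  have hw := multinomial_mul_planeRadii_le h (hc.trans_le ht1.le)
  -- The product `z₀ z₁` turns twice as fast as each coordinate: its angle is `4πs = π/N`.
  set s : ℝ := 1 / (4 * N) with hs
  set P := polarPoint _ hρ
  have hq : ∀ x, 2 * (P x).1 i₀ * (P x).1 i₁ =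
      (t : ℂ) * (fourier 1 (x i₀) * fourier 1 (x i₁)) := fun x => by
    rw [product_polarPoint, hc]
  have hqn : ∀ x, ‖2 * (P x).1 i₀ * (P x).1 i₁‖ = t := fun x => by
    rw [hq, norm_mul, norm_mul, norm_fourier_one, norm_fourier_one, mul_one, mul_one,
      Complex.norm_real, Real.norm_of_nonneg ht0]
  have hqr : ∀ x, 2 * (P (rotate s x)).1 i₀ * (P (rotate s x)).1 i₁ =
      Complex.exp (Complex.I * ((Real.pi / 256 ^ K : ℝ) : ℂ)) *
        (2 * (P x).1 i₀ * (P x).1 i₁) := fun x => by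
    have he : Complex.exp (Complex.I * ((Real.pi / 256 ^ K : ℝ) : ℂ)) =
        Complex.exp (Complex.I * ((2 * Real.pi * s : ℝ) : ℂ)) *
          Complex.exp (Complex.I * ((2 * Real.pi * s : ℝ) : ℂ)) := by
      rw [← Complex.exp_add, ← mul_add, ← Complex.ofReal_add]
      congr 3
      rw [hs, ← hN]
      field_simp
      norm_num
    rw [hq, hq, he]
    simp only [rotate, fourier_one_add_coe]
    ring
  have hpt : ∀ x, (1 / 4 : ℝ) ^ K * ‖m (P x)‖ ^ 2 ≤
      2 * ‖g (P (rotate s x)) - g (P x)‖ ^ 2 + 8 * ‖m (P (rotate s x)) - m (P x)‖ ^ 2 := by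
    intro x
    have h1 := le_norm_lacunary_sub K ((hqn x).trans_le ht1.le) (by rw [hqn]; exact htN)
    rw [← hqr] at h1
    have h2 := norm_lacunary_le ((hqn (rotate s x)).trans_le ht1.le)
    rw [hg, hg]
    set A := lacunary (2 * (P (rotate s x)).1 i₀ * (P (rotate s x)).1 i₁)
    set B := lacunary (2 * (P x).1 i₀ * (P x).1 i₁)
    set u := m (P (rotate s x))
    set v := m (P x)
    -- Moves the jump `A - B` onto increments of `g = uA` and of `m`, at the cost of the bound `|A|
    -- ≤ 2`.
    have h3 : v * (A - B) = (u * A - v * B) - A * (u - v) := by ring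
    have h4 : ‖v‖ * ‖A - B‖ ≤ ‖u * A - v * B‖ + 2 * ‖u - v‖ := by
      rw [← norm_mul, h3]
      refine (norm_sub_le _ _).trans ?_
      rw [norm_mul]
      gcongr
    have h5 : ‖v‖ * (1 / 2 : ℝ) ^ K ≤ ‖u * A - v * B‖ + 2 * ‖u - v‖ :=
      (mul_le_mul_of_nonneg_left h1 (norm_nonneg _)).trans h4
    calc (1 / 4 : ℝ) ^ K * ‖v‖ ^ 2 = (‖v‖ * (1 / 2 : ℝ) ^ K) ^ 2 := by
          rw [mul_pow, ← pow_mul, mul_comm K, pow_mul]; norm_num; ring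
      _ ≤ (‖u * A - v * B‖ + 2 * ‖u - v‖) ^ 2 := by gcongr
      _ ≤ _ := by nlinarith [sq_nonneg (‖u * A - v * B‖ - 2 * ‖u - v‖)]
  have hint : ∀ f : UnitAddTorus (Fin d) → ℝ, Continuous f → Integrable f (torusMeasure d) :=
    fun f hf => hf.integrable_of_hasCompactSupport (HasCompactSupport.of_compactSpace f)
  have hcont : ∀ a : DruryArveson d, Continuous fun x => a (P x) := fun a =>
    a.continuous_polarPoint _ hρ
  have hdiff : ∀ a : DruryArveson d, Continuous fun x => ‖a (P (rotate s x)) - a (P x)‖ ^ 2 :=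
    fun a => ((((hcont a).comp (continuous_rotate s)).sub (hcont a)).norm).pow 2
  have hs0 : 0 ≤ s := by positivity
  have hsqrt : √(2 * Real.pi * s) ≤ 2 * (1 / 16) ^ K := by
    rw [Real.sqrt_le_left (by positivity), mul_pow, ← pow_mul, mul_comm K, pow_mul]
    calc 2 * Real.pi * s ≤ 2 * 4 * s := by gcongr; exact Real.pi_le_four
      _ = 2 * (1 / N) := by rw [hs]; ring
      _ ≤ 2 ^ 2 * (1 / N) := by gcongr; norm_num
      _ = 2 ^ 2 * ((1 / 16) ^ 2) ^ K := by rw [hN, ← one_div_pow]; norm_num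
  have hg' := (hint _ (hdiff g)).const_mul 2
  have hm' := (hint _ (hdiff m)).const_mul 8
  have hI := integral_mono ((hint _ ((hcont m).norm.pow 2)).const_mul ((1 / 4 : ℝ) ^ K))
    (hg'.add hm') hpt
  simp only [Pi.add_apply, Pi.pow_apply] at hI
  rw [integral_add hg' hm', integral_const_mul, integral_const_mul, integral_const_mul] at hI
  have hIg := g.integral_rotate_sub_le _ hρ hw s hs0
  have hIm := m.integral_rotate_sub_le _ hρ hw s hs0
  have h0 := m.norm_sq_zero_le_integral _ hρ
  set v := ‖m ⟨0, Metric.mem_ball_self one_pos⟩‖ ^ 2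
  -- The right side is of order `√s`, that is `16⁻ᴷ`; it beats the squared jump `4⁻ᴷ` by the factor
  -- `4⁻ᴷ` that survives cancellation.
  have hfin : (1 / 4 : ℝ) ^ K * v ≤
      (1 / 4 : ℝ) ^ K * ((16 * ‖g‖ ^ 2 + 64 * ‖m‖ ^ 2) * (1 / 4 : ℝ) ^ K) := by
    calc (1 / 4 : ℝ) ^ K * v ≤ 2 * (4 * √(2 * Real.pi * s) * ‖g‖ ^ 2) +
          8 * (4 * √(2 * Real.pi * s) * ‖m‖ ^ 2) := by
          refine (mul_le_mul_of_nonneg_left h0 (by positivity)).trans (hI.trans ?_)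
          gcongr
      _ = √(2 * Real.pi * s) * (8 * ‖g‖ ^ 2 + 32 * ‖m‖ ^ 2) := by ring
      _ ≤ (2 * (1 / 16) ^ K) * (8 * ‖g‖ ^ 2 + 32 * ‖m‖ ^ 2) := by gcongr
      _ = _ := by
        rw [show (1 / 16 : ℝ) = 1 / 4 * (1 / 4) by norm_num, mul_pow]; ring
  exact le_of_mul_le_mul_left hfin (by positivity)

theorem eq_zero_of_lacunary_mul {d : ℕ} {i₀ i₁ : Fin d} (h : i₀ ≠ i₁) (g m : DruryArveson d)
    (hg : ∀ z : UnitBall d, g z = m z * lacunary (2 * z.1 i₀ * z.1 i₁)) :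
    m ⟨0, Metric.mem_ball_self one_pos⟩ = 0 := by
  have h1 : Tendsto (fun K : ℕ => (16 * ‖g‖ ^ 2 + 64 * ‖m‖ ^ 2) * (1 / 4 : ℝ) ^ K) atTop
      (𝓝 ((16 * ‖g‖ ^ 2 + 64 * ‖m‖ ^ 2) * 0)) :=
    (tendsto_pow_atTop_nhds_zero_of_lt_one (by norm_num) (by norm_num)).const_mul _
  have h2 := ge_of_tendsto' h1 (norm_sq_le_of_lacunary_mul h g m hg)
  rw [mul_zero] at h2
  have h3 := le_antisymm h2 (by positivity)
  simpa using h3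

/-- The monomial `z ^ α` as an element of the Drury--Arveson space. -/
noncomputable def DruryArveson.monomVec {d : ℕ} (α : Fin d → ℕ) : DruryArveson d :=
  show lp (fun _ : Fin d → ℕ => ℂ) 2 from lp.single 2 α (monomNorm α : ℂ)

theorem DruryArveson.monomVec_apply {d : ℕ} (α : Fin d → ℕ) (z : UnitBall d) :
    monomVec α z = monom z.1 α := by
  rw [apply_eq, tsum_eq_single α]
  · have h : coord (monomVec α) α = (monomNorm α : ℂ) := by
      simp [coord, monomVec]
    have h2 : (monomNorm α : ℂ) ≠ 0 := by exact_mod_cast (monomNorm_pos α).ne'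
    rw [h]
    field_simp
  · intro β hβ
    have h : coord (monomVec α) β = 0 := by
      simp [coord, monomVec, hβ]
    rw [h, zero_mul]

/-- Applying the multiplier to the constant `1` puts `m` in `H²_d`; the preceding estimates then
force a zero of `m` at the origin. -/
theorem lacunary_ne_quotient {d : ℕ} {i₀ i₁ : Fin d} (h : i₀ ≠ i₁) (g : DruryArveson d)
    (m : UnitBall d → ℂ) (hm : IsCyclicMultiplier m) :
    ¬∀ z : UnitBall d, lacunary (2 * z.1 i₀ * z.1 i₁) = g z / m z := by
  intro hf
  have h1 : ∀ z, hm.1.mulOp (DruryArveson.monomVec 0) z = m z := fun z => by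
    rw [IsMultiplier.mulOp_apply, DruryArveson.monomVec_apply]
    simp [monom]
  have h2 := eq_zero_of_lacunary_mul h g (hm.1.mulOp (DruryArveson.monomVec 0)) fun z => by
    rw [h1, hf, mul_div_cancel₀ _ (hm.ne_zero z)]
  exact hm.ne_zero _ ((h1 _).symm.trans h2)

/-! ### The topological argument. -/

namespace Smirnov

variable {d : ℕ}

theorem eval_add (f g : Smirnov d) (z : UnitBall d) : (f + g).eval z = f.eval z + g.eval z := rfl

theorem eval_sub (f g : Smirnov d) (z : UnitBall d) : (f - g).eval z = f.eval z - g.eval z := rfl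

theorem eval_zero (z : UnitBall d) : (0 : Smirnov d).eval z = 0 := rfl

theorem exists_eval_eq (f : Smirnov d) : ∃ (g : DruryArveson d) (m : UnitBall d → ℂ),
    IsCyclicMultiplier m ∧ ∀ z, f.eval z = g z / m z := f.2

/-- Elements of the Drury--Arveson space belong to the Smirnov class. -/
noncomputable def ofDruryArveson (a : DruryArveson d) : Smirnov d :=
  show ↥(smirnovSubmodule d) from ⟨fun z => a z, a, 1, IsCyclicMultiplier.one, fun z => by simp⟩

theorem eval_ofDruryArveson (a : DruryArveson d) (z : UnitBall d) :
    (ofDruryArveson a).eval z = a z := rfl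

/-- If uniform convergence to zero implies convergence to zero, a uniformly Cauchy sequence is
Cauchy. -/
theorem cauchy_of_uniform [TopologicalSpace (Smirnov d)]
    (F : ℕ → EuclideanSpace ℂ (Fin d) → ℂ) (f : ℕ → Smirnov d)
    (hF : UniformCauchySeqOn F atTop (Metric.closedBall 0 1))
    (h : ∀ φ ψ : ℕ → ℕ, TendstoUniformlyOn (fun n => F (φ n) - F (ψ n)) (fun _ => 0) atTop
      (Metric.closedBall 0 1) → Tendsto (fun n => f (φ n) - f (ψ n)) atTop (𝓝 0)) :
    ∀ U ∈ 𝓝 (0 : Smirnov d), ∃ N : ℕ, ∀ m ≥ N, ∀ n ≥ N, f m - f n ∈ U := by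
  intro U hU
  by_contra! hcon
  -- Failure of the Cauchy property gives index sequences with `φ N, ψ N ≥ N` whose differences all
  -- avoid `U`, though they tend uniformly to zero.
  choose φ hφ ψ hψ hmem using hcon
  have hu : TendstoUniformlyOn (fun n => F (φ n) - F (ψ n)) (fun _ => 0) atTop
      (Metric.closedBall 0 1) := by
    rw [Metric.tendstoUniformlyOn_iff]
    intro ε hε
    obtain ⟨N, hN⟩ := Metric.uniformCauchySeqOn_iff.1 hF ε hε
    filter_upwards [eventually_ge_atTop N] with n hn z hz
    have := hN _ (hn.trans (hφ n)) _ (hn.trans (hψ n)) z hz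
    simpa [dist_eq_norm, norm_sub_rev] using this
  obtain ⟨n, hn⟩ := ((h φ ψ hu).eventually hU).exists
  exact hmem n hn

end Smirnov

theorem proposition7p4 (d : ℕ) (hd : 2 ≤ d) [TopologicalSpace (Smirnov d)]
    [IsTopologicalAddGroup (Smirnov d)] [ContinuousSMul ℂ (Smirnov d)]
    (heval : ∀ z : UnitBall d, Continuous fun f : Smirnov d => f.eval z)
    (hcomplete : IsSeqCompleteTVS (Smirnov d)) :
    ∃ (F : ℕ → EuclideanSpace ℂ (Fin d) → ℂ) (f : ℕ → Smirnov d),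
      (∀ n, ∃ U : Set (EuclideanSpace ℂ (Fin d)), IsOpen U ∧
        Metric.closedBall 0 1 ⊆ U ∧ AnalyticOnNhd ℂ (F n) U) ∧
      (∀ n, ∀ z : UnitBall d, (f n).eval z = F n z) ∧
      TendstoUniformlyOn F (fun _ => 0) atTop (Metric.closedBall 0 1) ∧
      ¬ Tendsto f atTop (𝓝 0) := by
  by_contra hcon
  push Not at hcon
  let i₀ : Fin d := ⟨0, by omega⟩
  let i₁ : Fin d := ⟨1, by omega⟩
  have hi : i₀ ≠ i₁ := by simp [i₀, i₁]
  let S : ℕ → EuclideanSpace ℂ (Fin d) → ℂ := fun K z =>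
    ∑ k ∈ Finset.range K, (1 / 2 : ℂ) ^ k * (2 * z i₀ * z i₁) ^ 256 ^ k
  have hSan : ∀ K, AnalyticOnNhd ℂ (S K) Set.univ := by
    intro K
    have hproj : ∀ i : Fin d, AnalyticOnNhd ℂ (fun z : EuclideanSpace ℂ (Fin d) => z i) Set.univ :=
      fun i => (EuclideanSpace.proj (𝕜 := ℂ) i).analyticOnNhd _
    refine Finset.analyticOnNhd_fun_sum _ fun k _ => ?_
    exact analyticOnNhd_const.mul (((analyticOnNhd_const.mul (hproj i₀)).mul (hproj i₁)).pow _)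
  have hterm : ∀ n : ℕ, ∃ p : Smirnov d, ∀ z : UnitBall d,
      p.eval z = (2 * z.1 i₀ * z.1 i₁) ^ n := by
    intro n
    -- The power is `2ⁿ z^α` with `α` equal to `n` at `i₀` and `i₁`, and zero elsewhere.
    refine ⟨Smirnov.ofDruryArveson ((2 : ℂ) ^ n • DruryArveson.monomVec
      (Pi.single i₀ n + Pi.single i₁ n)), fun z => ?_⟩
    rw [Smirnov.eval_ofDruryArveson, RKHS.coe_smul, Pi.smul_apply, DruryArveson.monomVec_apply]
    have h1 : ∀ i, ∏ j, z.1 j ^ (Pi.single i n : Fin d → ℕ) j = z.1 i ^ n := fun i => by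
      simp [Pi.single_apply, pow_ite]
    simp only [monom, Pi.add_apply, pow_add, Finset.prod_mul_distrib, h1, smul_eq_mul, mul_pow,
      mul_assoc]
  have hs : ∀ K, ∃ p : Smirnov d, ∀ z : UnitBall d, p.eval z = S K z.1 := by
    intro K
    induction K with
    | zero => exact ⟨0, fun z => by simp [S, Smirnov.eval_zero]⟩
    | succ K ih =>
      obtain ⟨p, hp⟩ := ih
      obtain ⟨q, hq⟩ := hterm (256 ^ K)
      refine ⟨p + (1 / 2 : ℂ) ^ K • q, fun z => ?_⟩
      have h1 : ((1 / 2 : ℂ) ^ K • q).eval z = (1 / 2 : ℂ) ^ K * q.eval z := rfl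
      rw [Smirnov.eval_add, h1, hp, hq]
      simp only [S, Finset.sum_range_succ]
  choose s hsS using hs
  have hunif : UniformCauchySeqOn S atTop (Metric.closedBall 0 1) := by
    refine TendstoUniformlyOn.uniformCauchySeqOn (tendstoUniformlyOn_tsum_nat
      summable_geometric_two fun k z hz => norm_lacunary_term_le
        (norm_two_mul_mul_le hi z (by simpa using hz)) k)
  obtain ⟨x, hx⟩ := hcomplete s (Smirnov.cauchy_of_uniform S s hunif fun φ ψ hu =>
    hcon (fun n => S (φ n) - S (ψ n)) _
      (fun n => ⟨Set.univ, isOpen_univ, Set.subset_univ _, (hSan _).sub (hSan _)⟩)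
      (fun n z => by rw [Smirnov.eval_sub, hsS, hsS]; rfl) hu)
  obtain ⟨g, m, hm, hgm⟩ := x.exists_eval_eq
  refine lacunary_ne_quotient hi g m hm fun z => ?_
  rw [← hgm]
  have hz := norm_two_mul_mul_le hi z.1 (mem_ball_zero_iff.1 z.2).le
  -- The partial sums at `z` converge both to the lacunary value and, by continuity of evaluation,
  -- to the value of the `τ`-limit.
  refine tendsto_nhds_unique (hasSum_lacunary hz).tendsto_sum_nat ?_
  exact (((heval z).tendsto x).comp hx).congr fun K => hsS K z
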